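/- Consider a neural network with layers $f_0,\dots,f_L$ ($L\ge 1$) and widths $d_0=1,d_1,\dots,d_{L+1}$, where $d_l\ge 2$ for $1\le l\le L+1$. For a data input $x\in\mathbb{R}^{d_{L+1}}$, a label $y$ and a parameter $\theta=(\theta_1,\dots,\theta_L)$, the layer values are $f_{L+1}=x$, $f_l=f_l(\theta_l,f_{l+1})\in\mathbb{R}^{d_l}$ for $1\le l\le L$, and $f_0=f_0(y,f_1)\in\mathbb{R}$. For $0\le l\le k\le L+1$ let $\mathcal{J}^l_k$ be the Jacobian of $f_l$ with respect to $f_k$ at $(\theta,x,y)$, and $$GSC(k,l)=\frac{\|\mathcal{J}^l_k\|_{qm}\,\|f_k\|_2}{\|f_l\|_2},$$ where for an $m\times n$ matrix $A$ with singular values $s_1,\dots,s_{\min(m,n)}$ we put $\|A\|_{qm}=\sqrt{(s_1^2+\dots+s_{\min(m,n)}^2)/n}$. For a random variable $X$ let $\mathbb{Q}[X]=(\mathbb{E}[X^2])^{1/2}\in[0,\infty]$. Let $\theta$ be random, let $c_1,\dots,c_L$ be fixed positive constants, and let $\mathcal{X}\subseteq\mathbb{R}^{d_{L+1}}$ be the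 domain of data inputs. For $1\le l<L$ let $S_{l+1}$ be the set of vectors in $\mathbb{R}^{d_{l+1}}$ of length $c_{l+1}$, and let $S_{L+1}=\mathcal{X}$. Assume that, almost surely, $f_l(\theta_l,\cdot)$ is differentiable at all points of $S_{l+1}$ for $1\le l\le L$, with Jacobian denoted $\mathcal{J}_l(\theta_l,\cdot)$, and that $f_0(y,\cdot)$ is differentiable at all vectors of length $c_1$. Assume further: 1. The $\theta_l$, $1\le l\le L$, are independent of each other. 2. For all $1\le l\le L$ and $F\in S_{l+1}$, $f_l(\theta_l,F)$ is a uniformly random vector of length $c_l$. 3. For all $1\le l\le L$, $F\in S_{l+1}$ and unit vectors $U\in\mathbb{R}^{d_{l+1}}$, $\mathcal{J}_l(\theta_l,F)U$ can be written as $\ell u$, where $\ell$ is a random scalar independent of the pair $(u,f_l(\theta_l,F))$, and $u$, conditioned on $f_l(\theta_l,F)$, is uniformly distributed among the unit vectors orthogonal to $f_l(\theta_l,F)$. 4. For all $1\le l\le L$ and $F\in S_{l+1}$, $\left.\frac{d}{da}f_l(\theta_l,aF)\right|_{a=1}=0$ almost surely. Then for all $x\in\mathcal{X}$ and all $1\le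 l<k\le L+1$, $$\sqrt{\frac{d_k}{d_k-1}}\;\mathbb{Q}_\theta\, GSC(k,l)=\prod_{l'=l+1}^{k}\sqrt{\frac{d_{l'}}{d_{l'}-1}}\;\mathbb{Q}_\theta\, GSC(l',l'-1)$$ as an identity in $[0,\infty]$ (with $0\cdot\infty=0$). The identity also holds for $l=0<k\le L+1$ if the error layer is invariant to input scale as well, that is, if $\left.\frac{d}{da}f_0(y,aF)\right|_{a=1}=0$ for all $F\in\mathbb{R}^{d_1}$ of length $c_1$ (with the convention that $GSC(k,0)=0$ where $f_0=0$). -/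

import Mathlib

open MeasureTheory ProbabilityTheory
open scoped ENNReal

noncomputable section

/-- Column vectors of dimensionality `n`, with the Euclidean norm. -/
abbrev Vec (n : ℕ) : Type := EuclideanSpace ℝ (Fin n)

/-- The qm norm of a linear map (matrix) with `n` columns: the quadratic mean of its singular
values, where the sum of squares is divided by `n`. (Singular values are indexed from `0`, and those
with index at least the rank are `0`.) -/
def qmNorm {m n : ℕ} (A : Vec n →L[ℝ] Vec m) : ℝ :=
  √((∑ i ∈ Finset.range (min m n), (A : Vec n →ₗ[ℝ] Vec m).singularValues i ^ 2) / n)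

/-- The quadratic expectation `(E[X ^ 2]) ^ (1 / 2)`; it is `∞` if `X` is not square integrable. -/
def quadExp {Ω : Type*} [MeasurableSpace Ω] (μ : Measure Ω) (X : Ω → ℝ) : ℝ≥0∞ :=
  (∫⁻ ω, ENNReal.ofReal (X ω ^ 2) ∂μ) ^ (1 / 2 : ℝ)

/-- The uniform distribution on the unit sphere of a Euclidean space `V`: normalized surface
measure, regarded as a measure on `V`. (It is `0` if `V = 0`, where there are no unit vectors.) -/
def uniformUnit (V : Type*) [NormedAddCommGroup V] [InnerProductSpace ℝ V] [FiniteDimensional ℝ V]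
    [MeasurableSpace V] [BorelSpace V] : Measure V :=
  (((volume : Measure V).toSphere Set.univ)⁻¹ • (volume : Measure V).toSphere).map Subtype.val

/-- The uniform distribution on the vectors of length `c` in dimension `n`. -/
def uniformLength (n : ℕ) (c : ℝ) : Measure (Vec n) :=
  (uniformUnit (Vec n)).map (fun v => c • v)

/-- The uniform distribution on the unit vectors orthogonal to `v`. -/
def uniformOrthogonal {n : ℕ} (v : Vec n) : Measure (Vec n) :=
  (uniformUnit ((ℝ ∙ v)ᗮ : Submodule ℝ (Vec n))).map Subtype.val

/-- A neural network with layers `f_0, …, f_L`; data flow from the input layer `L + 1` down to the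
error layer `0`. Only the indices named in the field comments are ever used. -/
structure NeuralNetwork (Y : Type*) where
  /-- nominal depth -/
  L : ℕ
  /-- there is a prediction layer `f_1` -/
  one_le_L : 1 ≤ L
  /-- widths `d_0, …, d_{L+1}`; `d_{L+1}` is the dimensionality of the data input -/
  d : ℕ → ℕ
  d_zero : d 0 = 1
  /-- dimensionalities (possibly `0`) of the parameter sub-vectors `θ_1, …, θ_L` -/
  p : ℕ → ℕ
  /-- the layer functions `f_l(θ_l, F_{l+1})` for `1 ≤ l ≤ L` -/
  layer : (l : ℕ) → Vec (p l) → Vec (d (l + 1)) → Vec (d l)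
  /-- the error layer `f_0(y, F_1)` -/
  err : Y → Vec (d 1) → Vec (d 0)

namespace NeuralNetwork

variable {Y : Type*} (N : NeuralNetwork Y)

/-- The parameter vector; only the sub-vectors `θ_1, …, θ_L` are used. -/
abbrev Params : Type := (l : ℕ) → Vec (N.p l)

/-- The `l`-th layer as a map from the values of layer `l + 1` to the values of layer `l`. -/
def layerMap (θ : N.Params) (y : Y) : (l : ℕ) → Vec (N.d (l + 1)) → Vec (N.d l)
  | 0 => N.err y
  | l + 1 => N.layer (l + 1) (θ (l + 1))

/-- `f_l(θ, F_k) = f_l(θ_l, f_{l+1}(… f_{k-1}(θ_{k-1}, F_k) …))`. -/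
def between (θ : N.Params) (y : Y) (l k : ℕ) (h : l ≤ k) : Vec (N.d k) → Vec (N.d l) :=
  Nat.leRec (motive := fun k _ => Vec (N.d k) → Vec (N.d l)) id
    (fun k _ g F => g (N.layerMap θ y k F)) h

/-- The value `f_k` of layer `k ≤ L + 1` at the datapoint `(x, y)`; `f_{L+1} = x`. -/
def value (θ : N.Params) (x : Vec (N.d (N.L + 1))) (y : Y) (k : ℕ) (h : k ≤ N.L + 1) :
    Vec (N.d k) :=
  N.between θ y k (N.L + 1) h x

/-- The Jacobian of layer `l` with respect to layer `k`, at the datapoint `(x, y)`. -/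
def jacobian (θ : N.Params) (x : Vec (N.d (N.L + 1))) (y : Y) (k l : ℕ) (hlk : l ≤ k)
    (hk : k ≤ N.L + 1) : Vec (N.d k) →L[ℝ] Vec (N.d l) :=
  fderiv ℝ (N.between θ y l k hlk) (N.value θ x y k hk)

/-- The gradient scale coefficient `GSC(k, l)`, for `0 ≤ l ≤ k ≤ L + 1` (and `0` otherwise). -/
def gsc (k l : ℕ) (θ : N.Params) (x : Vec (N.d (N.L + 1))) (y : Y) : ℝ :=
  if h : l ≤ k ∧ k ≤ N.L + 1 then
    qmNorm (N.jacobian θ x y k l h.1 h.2) * ‖N.value θ x y k h.2‖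
      / ‖N.value θ x y l (h.1.trans h.2)‖
  else 0

/-- The conditions on layer `l` (with `1 ≤ l ≤ L`) when its input ranges over `S`, its output length
is `c`, and its parameter sub-vector is the random vector `θl`. -/
structure LayerCondition {Ω : Type*} [MeasurableSpace Ω] (μ : Measure Ω) [IsProbabilityMeasure μ]
    (l : ℕ) (θl : Ω → Vec (N.p l)) (c : ℝ) (S : Set (Vec (N.d (l + 1)))) : Prop where
  /-- the layer is a measurable function of its parameter and its input -/
  measurable : Measurable (fun q : Vec (N.p l) × Vec (N.d (l + 1)) => N.layer l q.1 q.2)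
  /-- almost surely, the layer is differentiable at all its inputs -/
  differentiable : ∀ᵐ ω ∂μ, ∀ F ∈ S, DifferentiableAt ℝ (N.layer l (θl ω)) F
  /-- `f_l(θ_l, F)` is a uniformly random vector of length `c` -/
  uniform : ∀ F ∈ S, μ.map (fun ω => N.layer l (θl ω) F) = uniformLength (N.d l) c
  /-- for each unit vector `U`, one can write `J_l(θ_l, F) U = ℓ u`, where the scalar `ℓ` is
  independent of `u` and `f_l(θ_l, F)`, and `u`, conditioned on `f_l(θ_l, F)`, is uniformly
  distributed among the unit vectors orthogonal to `f_l(θ_l, F)` -/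
  jacobian_apply : ∀ F ∈ S, ∀ U : Vec (N.d (l + 1)), ‖U‖ = 1 →
    ∃ (ℓ : Ω → ℝ) (u : Ω → Vec (N.d l)), Measurable ℓ ∧ Measurable u ∧
      (∀ᵐ ω ∂μ, fderiv ℝ (N.layer l (θl ω)) F U = ℓ ω • u ω) ∧
      IndepFun ℓ (fun ω => (u ω, N.layer l (θl ω) F)) μ ∧
      (∀ᵐ v ∂(μ.map (fun ω => N.layer l (θl ω) F)),
        condDistrib u (fun ω => N.layer l (θl ω) F) μ v = uniformOrthogonal v)
  /-- the derivative of `a ↦ f_l(θ_l, a F)` at `a = 1` is `0`, almost surely -/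
  scale : ∀ F ∈ S, ∀ᵐ ω ∂μ, HasDerivAt (fun a : ℝ => N.layer l (θl ω) (a • F)) 0 1

end NeuralNetwork

end

/-!
The identity is proved for second moments: with `n = d_k`, the weighted second moment
`n / (n - 1) * E[GSC(k, l) ^ 2]` is shown to satisfy `H(k + 1, l) = H(k, l) * H(k + 1, k)`
(`lintegral_gsc_sq_succ`); the theorem follows by induction on `k` and by taking square roots.

The square of the qm norm of a matrix with `n` columns is its squared Frobenius norm `frobSq`
divided by `n` (`qmNorm_sq`), so the question is how the expected squared Frobenius norm of the
Jacobian changes on passing from `k` to `k + 1`. By the chain rule the new Jacobian is `A B`, where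
`B` is the Jacobian of layer `k` at `f_{k+1}` and `A` is the old one, at `f_k`. Fix `f_{k+1}` and
the parameters of the layers below `k`, which are independent of all the others. A column of `B` is
then `ℓ u`, with `u` uniformly distributed among the unit vectors orthogonal to `f_k`, and `ℓ`
independent of `(u, f_k)`. A uniformly random unit vector of an `m`-dimensional space has second
moments `1 / m` in all directions. Since `A` annihilates `f_k`, by scale invariance, all of `A`
lives on the orthogonal complement of `f_k`, of dimension `d_k - 1`, and therefore
`E[‖A u‖ ^ 2 | f_k] = ‖A‖_F ^ 2 / (d_k - 1)` (`lintegral_norm_sq_uniformOrthogonal`). Summing over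
the columns gives `E ‖A B‖_F ^ 2 = E ‖A‖_F ^ 2 * E ‖B‖_F ^ 2 / (d_k - 1)`
(`lintegral_frobSq_comp`). The first factor does not depend on `f_{k+1}`, because `f_k` is uniformly
distributed whatever `f_{k+1}` is; hence the product survives the integration over `f_{k+1}` and
over the lower parameters (`lintegral_relJacobian_succ`). Dividing `A` by `‖f_l‖` makes the case
`l = 0`, where this length is random, no different from the others.

All integrals take values in `[0, ∞]`, so no moment has to be finite. Iterating them requires that
the Jacobians are jointly measurable in parameters and inputs. The layers are not assumed to be
continuous in their parameters, and `fderiv` need not be jointly measurable; it is replaced by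
`quotientDeriv`, a limit of difference quotients, which is, and which agrees with `fderiv` almost
surely along the values that the network takes.
-/

open scoped Pointwise

noncomputable section

/-! ### The Frobenius norm -/

/-- The squared Frobenius norm of a matrix: the sum of the squared lengths of its columns. -/
def frobSq {m n : ℕ} (A : Vec n →L[ℝ] Vec m) : ℝ :=
  ∑ i, ‖A (EuclideanSpace.basisFun (Fin n) ℝ i)‖ ^ 2

lemma frobSq_smul {m n : ℕ} (a : ℝ) (A : Vec n →L[ℝ] Vec m) :
    frobSq (a • A) = a ^ 2 * frobSq A := by
  simp [frobSq, norm_smul, mul_pow, Finset.mul_sum]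

lemma continuous_frobSq {m n : ℕ} : Continuous (frobSq : (Vec n →L[ℝ] Vec m) → ℝ) := by
  unfold frobSq
  fun_prop

section InnerProductSpace

variable {E F : Type*} [NormedAddCommGroup E] [InnerProductSpace ℝ E] [FiniteDimensional ℝ E]
  [NormedAddCommGroup F] [InnerProductSpace ℝ F] [FiniteDimensional ℝ F]

lemma sum_norm_sq_eq_trace {ι : Type*} [Fintype ι] (A : E →ₗ[ℝ] F) (b : OrthonormalBasis ι ℝ E) :
    ∑ i, ‖A (b i)‖ ^ 2 = (A.adjoint ∘ₗ A).trace ℝ E := by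
  rw [LinearMap.trace_eq_sum_inner _ b]
  refine Finset.sum_congr rfl fun i _ => ?_
  rw [LinearMap.comp_apply, LinearMap.adjoint_inner_right, real_inner_self_eq_norm_sq]

/-- A linear map becomes diagonal in an eigenbasis of `AᵀA`: its columns are then pairwise
orthogonal, so that no mixed terms appear in `‖A v‖ ^ 2`. -/
lemma exists_orthonormalBasis_norm_sq_apply (A : E →ₗ[ℝ] F) :
    ∃ b : OrthonormalBasis (Fin (Module.finrank ℝ E)) ℝ E,
      ∀ v, ‖A v‖ ^ 2 = ∑ i, ‖A (b i)‖ ^ 2 * inner ℝ (b i) v ^ 2 := by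
  have hT := A.isSymmetric_adjoint_comp_self
  set b := hT.eigenvectorBasis rfl with hb
  refine ⟨b, fun v => ?_⟩
  have hin : ∀ i w, inner ℝ (A (b i)) (A w) = hT.eigenvalues rfl i * inner ℝ (b i) w := by
    intro i w
    rw [← LinearMap.adjoint_inner_left, ← LinearMap.comp_apply, hb,
      hT.apply_eigenvectorBasis rfl i, real_inner_smul_left]
    simp
  have hsq : ∀ i, ‖A (b i)‖ ^ 2 = hT.eigenvalues rfl i := by
    intro i
    rw [← real_inner_self_eq_norm_sq, hin, real_inner_self_eq_norm_sq, b.orthonormal.1 i]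
    simp
  have hv : A v = ∑ i, inner ℝ (b i) v • A (b i) := by
    conv_lhs => rw [← b.sum_repr' v]
    simp
  rw [← real_inner_self_eq_norm_sq]
  conv_lhs => rw [hv]
  rw [sum_inner]
  refine Finset.sum_congr rfl fun i _ => ?_
  rw [real_inner_smul_left, ← hv, hin, hsq]
  ring

end InnerProductSpace

lemma qmNorm_sq {m n : ℕ} (A : Vec n →L[ℝ] Vec m) : qmNorm A ^ 2 = frobSq A / n := by
  have hn : Module.finrank ℝ (Vec n) = n := by simp
  have hrank : ∀ i ∈ Finset.range n, i ∉ Finset.range (min m n) →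
      (A : Vec n →ₗ[ℝ] Vec m).singularValues i ^ 2 = 0 := by
    intro i hi hi'
    have h : m ≤ i := by
      simp only [Finset.mem_range] at hi hi'
      omega
    have : (A : Vec n →ₗ[ℝ] Vec m).singularValues i = 0 := by
      rw [LinearMap.singularValues_eq_zero_iff_le_finrank_range]
      refine (Submodule.finrank_le _).trans ?_
      simpa using h
    simp [this]
  have hsum : ∑ i ∈ Finset.range (min m n), (A : Vec n →ₗ[ℝ] Vec m).singularValues i ^ 2
      = frobSq A := by
    rw [Finset.sum_subset (Finset.range_subset_range.2 (min_le_right m n)) hrank,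
      Finset.sum_range]
    rw [frobSq]
    refine Eq.trans ?_
      (sum_norm_sq_eq_trace (A : Vec n →ₗ[ℝ] Vec m) (EuclideanSpace.basisFun (Fin n) ℝ)).symm
    rw [(LinearMap.isSymmetric_adjoint_comp_self _).trace_eq_sum_eigenvalues (hn := hn)]
    exact Finset.sum_congr rfl fun i _ => LinearMap.sq_singularValues_fin _ hn i
  rw [qmNorm, Real.sq_sqrt (by positivity), hsum]

/-! ### Second moments of uniformly random unit vectors -/

section UniformUnit

variable {V : Type*} [NormedAddCommGroup V] [InnerProductSpace ℝ V] [FiniteDimensional ℝ V]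
    [MeasurableSpace V] [BorelSpace V]

lemma ae_norm_uniformUnit : ∀ᵐ v ∂(uniformUnit V), ‖v‖ = 1 := by
  rw [uniformUnit, ae_map_iff (by fun_prop) (measurableSet_eq_fun (by fun_prop) (by fun_prop))]
  exact Filter.Eventually.of_forall fun v => by simp

lemma isProbabilityMeasure_uniformUnit [Nontrivial V] :
    IsProbabilityMeasure (uniformUnit V) := by
  constructor
  rw [uniformUnit, Measure.map_apply (by fun_prop) MeasurableSet.univ]
  simp only [Set.preimage_univ, Measure.smul_apply, smul_eq_mul]
  refine ENNReal.inv_mul_cancel ?_ (measure_ne_top _ _)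
  rw [Ne, Measure.measure_univ_eq_zero]
  exact Measure.toSphere_ne_zero _

lemma map_uniformUnit (R : V ≃ₗᵢ[ℝ] V) : (uniformUnit V).map R = uniformUnit V := by
  ext s hs
  have hR : MeasurableSet (R ⁻¹' s) := R.continuous.measurable hs
  have hval : Measurable (Subtype.val : Metric.sphere (0 : V) 1 → V) := measurable_subtype_coe
  have key : ∀ t : Set V, MeasurableSet t → (volume : Measure V).toSphere (Subtype.val ⁻¹' t)
      = Module.finrank ℝ V *
        volume (Set.Ioo (0 : ℝ) 1 • (t ∩ Metric.sphere (0 : V) 1)) := by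
    intro t ht
    rw [Measure.toSphere_apply' _ (hval ht), Subtype.image_preimage_coe, Set.inter_comm]
  rw [Measure.map_apply R.continuous.measurable hs, uniformUnit, Measure.map_apply hval hR,
    Measure.map_apply hval hs, Measure.smul_apply, Measure.smul_apply, key _ hR, key _ hs]
  have hset : Set.Ioo (0 : ℝ) 1 • (R ⁻¹' s ∩ Metric.sphere (0 : V) 1)
      = R ⁻¹' (Set.Ioo (0 : ℝ) 1 • (s ∩ Metric.sphere (0 : V) 1)) := by
    ext v
    simp only [Set.mem_smul, Set.mem_preimage, Set.mem_inter_iff, mem_sphere_zero_iff_norm]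
    constructor
    · rintro ⟨a, ha, w, ⟨hw, hw'⟩, rfl⟩
      exact ⟨a, ha, R w, ⟨hw, by simpa using hw'⟩, by simp⟩
    · rintro ⟨a, ha, w, ⟨hw, hw'⟩, h⟩
      refine ⟨a, ha, R.symm w, ⟨by simpa using hw, by simpa using hw'⟩, ?_⟩
      rw [← map_smul, h, R.symm_apply_apply]
  rw [hset, R.measurePreserving.measure_preimage_emb
    R.toHomeomorph.measurableEmbedding]

/-- By symmetry, the squared coordinates of a uniformly random unit vector have equal expectations;
they add up to `1`. -/
lemma lintegral_inner_sq_uniformUnit [Nontrivial V] {ι : Type*} [Fintype ι] [DecidableEq ι]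
    (b : OrthonormalBasis ι ℝ V) (i : ι) :
    ∫⁻ v, ENNReal.ofReal (inner ℝ (b i) v ^ 2) ∂(uniformUnit V) = (Fintype.card ι : ℝ≥0∞)⁻¹ := by
  have := isProbabilityMeasure_uniformUnit (V := V)
  have hm : ∀ j, Measurable fun v : V => ENNReal.ofReal (inner ℝ (b j) v ^ 2) := fun j => by
    fun_prop
  have heq : ∀ j, ∫⁻ v, ENNReal.ofReal (inner ℝ (b j) v ^ 2) ∂(uniformUnit V)
      = ∫⁻ v, ENNReal.ofReal (inner ℝ (b i) v ^ 2) ∂(uniformUnit V) := by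
    intro j
    -- an isometry that exchanges the two basis vectors
    set R : V ≃ₗᵢ[ℝ] V := b.equiv b (Equiv.swap i j) with hR
    have hRi : R (b i) = b j := by rw [hR, OrthonormalBasis.equiv_apply_basis]; simp
    conv_lhs => rw [← map_uniformUnit R]
    rw [lintegral_map (hm j) R.continuous.measurable]
    simp_rw [← hRi, LinearIsometryEquiv.inner_map_map]
  have hsum : ∑ j, ∫⁻ v, ENNReal.ofReal (inner ℝ (b j) v ^ 2) ∂(uniformUnit V) = 1 := by
    rw [← lintegral_finsetSum _ fun j _ => hm j]
    rw [lintegral_congr_ae (g := fun _ => 1)]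
    · simp
    filter_upwards [ae_norm_uniformUnit] with v hv
    rw [← ENNReal.ofReal_sum_of_nonneg fun _ _ => sq_nonneg _]
    rw [b.sum_sq_inner_right, hv]
    simp
  simp_rw [heq] at hsum
  rw [Finset.sum_const, nsmul_eq_mul, Finset.card_univ] at hsum
  exact ENNReal.eq_inv_of_mul_eq_one_left ((mul_comm _ _).trans hsum)

lemma lintegral_norm_sq_uniformUnit [Nontrivial V] {F : Type*} [NormedAddCommGroup F]
    [InnerProductSpace ℝ F] [FiniteDimensional ℝ F] {ι : Type*} [Fintype ι]
    (b : OrthonormalBasis ι ℝ V) (A : V →ₗ[ℝ] F) :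
    ∫⁻ v, ENNReal.ofReal (‖A v‖ ^ 2) ∂(uniformUnit V)
      = ENNReal.ofReal (∑ i, ‖A (b i)‖ ^ 2) / Module.finrank ℝ V := by
  obtain ⟨e, he⟩ := exists_orthonormalBasis_norm_sq_apply A
  rw [lintegral_congr fun v => congrArg ENNReal.ofReal (he v), sum_norm_sq_eq_trace A b,
    ← sum_norm_sq_eq_trace A e,
    ENNReal.ofReal_sum_of_nonneg fun _ _ => sq_nonneg _]
  have : ∀ v, ENNReal.ofReal (∑ i, ‖A (e i)‖ ^ 2 * inner ℝ (e i) v ^ 2)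
      = ∑ i, ENNReal.ofReal (‖A (e i)‖ ^ 2) * ENNReal.ofReal (inner ℝ (e i) v ^ 2) := by
    intro v
    rw [ENNReal.ofReal_sum_of_nonneg fun _ _ => by positivity]
    exact Finset.sum_congr rfl fun i _ => ENNReal.ofReal_mul (sq_nonneg _)
  simp_rw [this]
  rw [lintegral_finsetSum _ fun j _ => by fun_prop]
  simp_rw [lintegral_const_mul' _ _ ENNReal.ofReal_ne_top, lintegral_inner_sq_uniformUnit e]
  rw [← Finset.sum_mul, ENNReal.div_eq_inv_mul, mul_comm, Fintype.card_fin]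

end UniformUnit

lemma ae_norm_uniformLength {n : ℕ} {c : ℝ} (hc : 0 < c) :
    ∀ᵐ v ∂(uniformLength n c), ‖v‖ = c := by
  rw [uniformLength, ae_map_iff (by fun_prop) (measurableSet_eq_fun (by fun_prop) (by fun_prop))]
  filter_upwards [ae_norm_uniformUnit] with v hv
  rw [norm_smul, hv, Real.norm_of_nonneg hc.le, mul_one]

lemma ae_norm_uniformOrthogonal {n : ℕ} (v : Vec n) : ∀ᵐ u ∂(uniformOrthogonal v), ‖u‖ = 1 := by
  rw [uniformOrthogonal,
    ae_map_iff (by fun_prop) (measurableSet_eq_fun (by fun_prop) (by fun_prop))]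
  filter_upwards [ae_norm_uniformUnit] with u hu
  simpa using hu

/-- If `A` annihilates `v`, the whole Frobenius norm of `A` lives on the orthogonal complement of
`v`, which has dimension `n - 1`. -/
lemma lintegral_norm_sq_uniformOrthogonal {m n : ℕ} (hn : 2 ≤ n) {v : Vec n} (hv : v ≠ 0)
    (A : Vec n →L[ℝ] Vec m) (hA : A v = 0) :
    ∫⁻ u, ENNReal.ofReal (‖A u‖ ^ 2) ∂(uniformOrthogonal v)
      = ENNReal.ofReal (frobSq A) / ENNReal.ofReal ((n : ℝ) - 1) := by
  have hfin : Module.finrank ℝ ((ℝ ∙ v)ᗮ : Submodule ℝ (Vec n)) + 1 = n := by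
    have := (ℝ ∙ v).finrank_add_finrank_orthogonal
    rw [finrank_span_singleton hv, finrank_euclideanSpace_fin] at this
    omega
  have : Nontrivial ((ℝ ∙ v)ᗮ : Submodule ℝ (Vec n)) :=
    Module.nontrivial_of_finrank_pos (R := ℝ) (by omega)
  have hdim : ENNReal.ofReal ((n : ℝ) - 1)
      = (Module.finrank ℝ ((ℝ ∙ v)ᗮ : Submodule ℝ (Vec n)) : ℝ≥0∞) := by
    rw [← ENNReal.ofReal_natCast]
    congr 1
    rw [sub_eq_iff_eq_add]
    exact_mod_cast hfin.symm
  rw [uniformOrthogonal, lintegral_map (by fun_prop) (by fun_prop), hdim]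
  set W : Submodule ℝ (Vec n) := (ℝ ∙ v)ᗮ
  set A' : Vec n →ₗ[ℝ] Vec m := (A : Vec n →ₗ[ℝ] Vec m)
  have key := lintegral_norm_sq_uniformUnit (stdOrthonormalBasis ℝ W) (A' ∘ₗ W.subtype)
  -- `W.subtype ∘ₗ W.subtype.adjoint` is the orthogonal projection onto `W`
  have hproj : A' ∘ₗ (W.subtype ∘ₗ W.subtype.adjoint) = A' := by
    ext1 x
    have hmem : x - W.subtype (W.subtype.adjoint x) ∈ Wᗮ := by
      rw [Submodule.mem_orthogonal]
      intro w hw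
      have := W.subtype.adjoint_inner_right ⟨w, hw⟩ x
      rw [inner_sub_right, sub_eq_zero]
      exact this.symm
    rw [Submodule.orthogonal_orthogonal, Submodule.mem_span_singleton] at hmem
    obtain ⟨a, ha⟩ := hmem
    have h0 : A' (x - W.subtype (W.subtype.adjoint x)) = 0 := by
      rw [← ha, map_smul]
      exact (congrArg (a • ·) hA).trans (smul_zero a)
    rw [map_sub, sub_eq_zero] at h0
    exact h0.symm
  have htrace : ∑ i, ‖(A' ∘ₗ W.subtype) (stdOrthonormalBasis ℝ W i)‖ ^ 2 = frobSq A := by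
    rw [sum_norm_sq_eq_trace, frobSq]
    refine Eq.trans ?_ (sum_norm_sq_eq_trace A' (EuclideanSpace.basisFun (Fin n) ℝ)).symm
    rw [LinearMap.adjoint_comp, LinearMap.comp_assoc, LinearMap.trace_comp_comm',
      LinearMap.comp_assoc, LinearMap.comp_assoc, hproj]
  rw [htrace] at key
  exact key

/-! ### A jointly measurable derivative -/

lemma measurable_clm_apply {α : Type*} [MeasurableSpace α] {m n : ℕ} {A : α → Vec n →L[ℝ] Vec m}
    {v : α → Vec n} (hA : Measurable A) (hv : Measurable v) : Measurable fun a => A a (v a) :=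
  isBoundedBilinearMap_apply.continuous.measurable.comp (hA.prodMk hv)

lemma measurable_clm_comp {α : Type*} [MeasurableSpace α] {m n r : ℕ}
    {A : α → Vec n →L[ℝ] Vec m} {B : α → Vec r →L[ℝ] Vec n} (hA : Measurable A)
    (hB : Measurable B) : Measurable fun a => A a ∘L B a :=
  isBoundedBilinearMap_comp.continuous.measurable.comp (hA.prodMk hB)

lemma measurable_frobSq {m n : ℕ} :
    Measurable fun B : Vec n →L[ℝ] Vec m => ENNReal.ofReal (frobSq B) :=
  continuous_frobSq.measurable.ennreal_ofReal

/-- The matrix of partial derivatives of `g` at `F`, computed as limits of difference quotients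
along the steps `1 / (N + 1)` (with arbitrary columns where these do not converge). It agrees with
`fderiv ℝ g F` where `g` is differentiable at `F`. If `g` depends on a parameter and is jointly
measurable in it and its argument, then so is this matrix, which is not clear for `fderiv`. -/
@[irreducible]
def quotientDeriv {m n : ℕ} (g : Vec n → Vec m) (F : Vec n) : Vec n →L[ℝ] Vec m :=
  ∑ i, (EuclideanSpace.proj i : Vec n →L[ℝ] ℝ).smulRight
    (Filter.limUnder Filter.atTop fun N : ℕ =>
      ((N : ℝ) + 1) • (g (F + ((N : ℝ) + 1)⁻¹ • EuclideanSpace.basisFun (Fin n) ℝ i) - g F))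

lemma quotientDeriv_eq_fderiv {m n : ℕ} {g : Vec n → Vec m} {F : Vec n}
    (hg : DifferentiableAt ℝ g F) : quotientDeriv g F = fderiv ℝ g F := by
  have hlim : ∀ i, (Filter.limUnder Filter.atTop fun N : ℕ =>
      ((N : ℝ) + 1) • (g (F + ((N : ℝ) + 1)⁻¹ • EuclideanSpace.basisFun (Fin n) ℝ i) - g F))
      = fderiv ℝ g F (EuclideanSpace.basisFun (Fin n) ℝ i) := by
    intro i
    exact ((hg.hasFDerivAt.lim_real _).comp
      (Filter.tendsto_atTop_add_const_right _ 1 tendsto_natCast_atTop_atTop)).limUnder_eq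
  ext1 v
  conv_rhs => rw [← (EuclideanSpace.basisFun (Fin n) ℝ).sum_repr v, map_sum]
  simp only [quotientDeriv, hlim, _root_.sum_apply,
    ContinuousLinearMap.smulRight_apply, map_smul]
  rfl

lemma measurable_quotientDeriv {α : Type*} [MeasurableSpace α] {m n : ℕ}
    {g : α → Vec n → Vec m} (hg : Measurable fun q : α × Vec n => g q.1 q.2) :
    Measurable fun q : α × Vec n => quotientDeriv (g q.1) q.2 := by
  unfold quotientDeriv
  refine Finset.measurable_sum _ fun i _ => ?_
  refine (ContinuousLinearMap.smulRightL ℝ (Vec n) (Vec m)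
    (EuclideanSpace.proj i : Vec n →L[ℝ] ℝ)).continuous.measurable.comp ?_
  refine (StronglyMeasurable.limUnder fun N => Measurable.stronglyMeasurable ?_).measurable
  have hshift : Measurable fun q : α × Vec n =>
      g q.1 (q.2 + ((N : ℝ) + 1)⁻¹ • EuclideanSpace.basisFun (Fin n) ℝ i) :=
    hg.comp (measurable_fst.prodMk (measurable_snd.add_const _))
  exact (hshift.sub hg).const_smul ((N : ℝ) + 1)

/-- Euler's identity in degree `0`. -/
lemma fderiv_apply_self_eq_zero {m n : ℕ} {g : Vec n → Vec m} {F : Vec n}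
    (hg : DifferentiableAt ℝ g F) (h : HasDerivAt (fun a : ℝ => g (a • F)) 0 1) :
    fderiv ℝ g F F = 0 := by
  have h1 : HasDerivAt (fun a : ℝ => a • F) F 1 := by
    simpa using (hasDerivAt_id (1 : ℝ)).smul_const F
  have h2 : HasFDerivAt g (fderiv ℝ g F) ((1 : ℝ) • F) := by
    rw [one_smul]
    exact hg.hasFDerivAt
  exact (h2.comp_hasDerivAt (1 : ℝ) h1).unique h

/-! ### Independence and iterated integrals -/

section Independence

variable {Ω : Type*} [MeasurableSpace Ω] {μ : Measure Ω} [IsProbabilityMeasure μ]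
  {α β : Type*} [MeasurableSpace α] [MeasurableSpace β] {X : Ω → α} {Y : Ω → β}

lemma lintegral_of_indepFun (h : IndepFun X Y μ) (hX : Measurable X) (hY : Measurable Y)
    {g : α × β → ℝ≥0∞} (hg : Measurable g) :
    ∫⁻ ω, g (X ω, Y ω) ∂μ = ∫⁻ ω, ∫⁻ ω', g (X ω, Y ω') ∂μ ∂μ := by
  have := Measure.isProbabilityMeasure_map (μ := μ) hX.aemeasurable
  have := Measure.isProbabilityMeasure_map (μ := μ) hY.aemeasurable
  rw [← lintegral_map (f := g) (g := fun ω => (X ω, Y ω)) hg (hX.prodMk hY),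
    h.map_prod_eq_prod_map_map hX.aemeasurable hY.aemeasurable, lintegral_prod _ hg.aemeasurable,
    lintegral_map hg.lintegral_prod_right' hX]
  refine lintegral_congr fun ω => ?_
  exact lintegral_map (f := fun y => g (X ω, y)) (hg.comp measurable_prodMk_left) hY

lemma ae_iff_of_indepFun (h : IndepFun X Y μ) (hX : Measurable X) (hY : Measurable Y)
    {s : Set (α × β)} (hs : MeasurableSet s) :
    (∀ᵐ ω ∂μ, (X ω, Y ω) ∈ s) ↔ ∀ᵐ ω ∂μ, ∀ᵐ ω' ∂μ, (X ω, Y ω') ∈ s := by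
  have := Measure.isProbabilityMeasure_map (μ := μ) hX.aemeasurable
  have := Measure.isProbabilityMeasure_map (μ := μ) hY.aemeasurable
  have hs' : MeasurableSet {q | q ∈ s} := hs
  rw [← ae_map_iff (f := fun ω => (X ω, Y ω)) (p := fun q => q ∈ s) (hX.prodMk hY).aemeasurable hs,
    h.map_prod_eq_prod_map_map hX.aemeasurable hY.aemeasurable,
    Measure.ae_prod_iff_ae_ae (p := fun q => q ∈ s) hs']
  have hae : MeasurableSet {a | ∀ᵐ b ∂(μ.map Y), (a, b) ∈ s} :=
    measurable_measure_prodMk_left (ν := μ.map Y) hs.compl (measurableSet_singleton 0)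
  rw [ae_map_iff hX.aemeasurable hae]
  refine Filter.eventually_congr (Filter.Eventually.of_forall fun ω => ?_)
  exact ae_map_iff hY.aemeasurable (measurable_prodMk_left hs')

end Independence

/-! ### A single random layer -/

/-- Let each column of the random matrix `B` have a direction that is uniformly distributed among
those orthogonal to the random vector `f`, and a scale that is independent of `f` and of this
direction, and let `A f` annihilate `f`. Since only `n - 1` of the `n` dimensions are available to
the columns of `B`, and the whole Frobenius norm of `A f` lives on these, the expectations of the
squared Frobenius norms multiply up to a factor `n - 1`. -/
lemma lintegral_frobSq_comp {Ω : Type*} [MeasurableSpace Ω] {μ : Measure Ω}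
    [IsProbabilityMeasure μ] {m n r : ℕ} (hn : 2 ≤ n) {f : Ω → Vec n} {B : Ω → Vec m →L[ℝ] Vec n}
    (hf : Measurable f) (hB : Measurable B) {c : ℝ} (hc : 0 < c)
    (hunif : μ.map f = uniformLength n c)
    (hjac : ∀ U : Vec m, ‖U‖ = 1 → ∃ (ℓ : Ω → ℝ) (u : Ω → Vec n), Measurable ℓ ∧ Measurable u ∧
      (∀ᵐ ω ∂μ, B ω U = ℓ ω • u ω) ∧ IndepFun ℓ (fun ω => (u ω, f ω)) μ ∧
      (∀ᵐ v ∂(μ.map f), condDistrib u f μ v = uniformOrthogonal v))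
    {A : Vec n → Vec n →L[ℝ] Vec r} (hA : Measurable A)
    (hA0 : ∀ᵐ ω ∂μ, A (f ω) (f ω) = 0) :
    ∫⁻ ω, ENNReal.ofReal (frobSq (A (f ω) ∘L B ω)) ∂μ
      = (∫⁻ ω, ENNReal.ofReal (frobSq (A (f ω))) ∂μ) / ENNReal.ofReal ((n : ℝ) - 1)
        * ∫⁻ ω, ENNReal.ofReal (frobSq (B ω)) ∂μ := by
  have hfrob : Measurable fun v => ENNReal.ofReal (frobSq (A v)) :=
    measurable_frobSq.comp hA
  have hne : ∀ᵐ v ∂(μ.map f), v ≠ 0 := by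
    rw [hunif]
    filter_upwards [ae_norm_uniformLength hc] with v hv h0
    rw [h0, norm_zero] at hv
    exact hc.ne hv
  have hA0' : ∀ᵐ v ∂(μ.map f), A v v = 0 := by
    exact (ae_map_iff hf.aemeasurable
      (measurableSet_eq_fun (measurable_clm_apply hA measurable_id) measurable_const)).2 hA0
  have hcol : ∀ U : Vec m, ‖U‖ = 1 → ∫⁻ ω, ENNReal.ofReal (‖A (f ω) (B ω U)‖ ^ 2) ∂μ
      = (∫⁻ ω, ENNReal.ofReal (frobSq (A (f ω))) ∂μ) / ENNReal.ofReal ((n : ℝ) - 1)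
        * ∫⁻ ω, ENNReal.ofReal (‖B ω U‖ ^ 2) ∂μ := by
    intro U hU
    obtain ⟨ℓ, u, hℓ, hu, hBU, hind, hcond⟩ := hjac U hU
    have hjoint : ∀ g : Vec n × Vec n → ℝ≥0∞, Measurable g → ∫⁻ ω, g (f ω, u ω) ∂μ
        = ∫⁻ v, ∫⁻ w, g (v, w) ∂(uniformOrthogonal v) ∂(μ.map f) := by
      intro g hg
      rw [← lintegral_map (f := g) hg (hf.prodMk hu), ← compProd_map_condDistrib hu.aemeasurable,
        Measure.lintegral_compProd hg]
      refine lintegral_congr_ae ?_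
      filter_upwards [hcond] with v hv
      rw [hv]
    have hu1 : ∀ᵐ ω ∂μ, ‖u ω‖ = 1 := by
      have hms : MeasurableSet {q : Vec n × Vec n | ‖q.2‖ = 1} :=
        measurableSet_eq_fun (by fun_prop) (by fun_prop)
      refine (ae_map_iff (hf.prodMk hu).aemeasurable hms).1 ?_
      rw [← compProd_map_condDistrib hu.aemeasurable]
      refine (Measure.ae_compProd_iff hms).2 ?_
      filter_upwards [hcond] with v hv
      rw [hv]
      exact ae_norm_uniformOrthogonal v
    have hAu : ∫⁻ ω, ENNReal.ofReal (‖A (f ω) (u ω)‖ ^ 2) ∂μ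
        = (∫⁻ ω, ENNReal.ofReal (frobSq (A (f ω))) ∂μ) / ENNReal.ofReal ((n : ℝ) - 1) := by
      rw [hjoint (fun q => ENNReal.ofReal (‖A q.1 q.2‖ ^ 2))
        (((measurable_clm_apply (hA.comp measurable_fst) measurable_snd).norm.pow_const
          2).ennreal_ofReal),
        ← lintegral_map (f := fun v => ENNReal.ofReal (frobSq (A v))) hfrob hf]
      simp only [ENNReal.div_eq_inv_mul]
      rw [← lintegral_const_mul _ hfrob]
      refine lintegral_congr_ae ?_
      filter_upwards [hne, hA0'] with v hv hv0
      rw [lintegral_norm_sq_uniformOrthogonal hn hv (A v) hv0, ENNReal.div_eq_inv_mul]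
    have hB1 : ∫⁻ ω, ENNReal.ofReal (‖B ω U‖ ^ 2) ∂μ = ∫⁻ ω, ENNReal.ofReal (ℓ ω ^ 2) ∂μ := by
      refine lintegral_congr_ae ?_
      filter_upwards [hBU, hu1] with ω h1 h2
      rw [h1, norm_smul, h2, mul_one, Real.norm_eq_abs, sq_abs]
    have hABU : ∫⁻ ω, ENNReal.ofReal (‖A (f ω) (B ω U)‖ ^ 2) ∂μ
        = ∫⁻ ω, ENNReal.ofReal (‖A (f ω) (u ω)‖ ^ 2) * ENNReal.ofReal (ℓ ω ^ 2) ∂μ := by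
      refine lintegral_congr_ae ?_
      filter_upwards [hBU] with ω h1
      rw [h1, map_smul, norm_smul, mul_pow, Real.norm_eq_abs, sq_abs,
        ENNReal.ofReal_mul (sq_nonneg _), mul_comm]
    have hind' : IndepFun (fun ω => ENNReal.ofReal (‖A (f ω) (u ω)‖ ^ 2))
        (fun ω => ENNReal.ofReal (ℓ ω ^ 2)) μ :=
      (hind.comp (φ := fun a => ENNReal.ofReal (a ^ 2))
        (ψ := fun q : Vec n × Vec n => ENNReal.ofReal (‖A q.2 q.1‖ ^ 2)) (by fun_prop)
        (((measurable_clm_apply (hA.comp measurable_snd) measurable_fst).norm.pow_const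
          2).ennreal_ofReal)).symm
    rw [hABU, hB1, ← hAu]
    exact lintegral_mul_eq_lintegral_mul_lintegral_of_indepFun
      ((measurable_clm_apply (hA.comp hf) hu).norm.pow_const 2).ennreal_ofReal
      (hℓ.pow_const 2).ennreal_ofReal hind'
  have hcolB : ∀ i, Measurable fun ω =>
      B ω (EuclideanSpace.basisFun (Fin m) ℝ i) := fun i => hB.apply_continuousLinearMap _
  have hsum : ∀ {q : ℕ} (C : Vec m →L[ℝ] Vec q), ENNReal.ofReal (frobSq C)
      = ∑ i, ENNReal.ofReal (‖C (EuclideanSpace.basisFun (Fin m) ℝ i)‖ ^ 2) := fun C =>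
    ENNReal.ofReal_sum_of_nonneg fun _ _ => sq_nonneg _
  simp_rw [hsum, ContinuousLinearMap.comp_apply]
  rw [lintegral_finsetSum _ fun i _ => ?_, lintegral_finsetSum _ fun i _ => ?_, Finset.mul_sum]
  · exact Finset.sum_congr rfl fun i _ =>
      hcol _ ((EuclideanSpace.basisFun (Fin m) ℝ).orthonormal.1 i)
  · exact ((hcolB i).norm.pow_const 2).ennreal_ofReal
  · exact ((measurable_clm_apply (hA.comp hf) (hcolB i)).norm.pow_const 2).ennreal_ofReal

/-! ### Compositions of layers -/

namespace NeuralNetwork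

variable {Y : Type*} (N : NeuralNetwork Y)

lemma between_self (θ : N.Params) (y : Y) (l : ℕ) (F : Vec (N.d l)) :
    N.between θ y l l le_rfl F = F := by
  rw [between, Nat.leRec_self]
  rfl

lemma between_succ (θ : N.Params) (y : Y) {l k : ℕ} (h : l ≤ k) (F : Vec (N.d (k + 1))) :
    N.between θ y l (k + 1) (h.trans k.le_succ) F = N.between θ y l k h (N.layerMap θ y k F) := by
  rw [between, Nat.leRec_succ _ _ h]
  rfl

lemma between_succ_self (θ : N.Params) (y : Y) (l : ℕ) :
    N.between θ y l (l + 1) l.le_succ = N.layerMap θ y l := by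
  funext F
  rw [between_succ N θ y le_rfl, between_self]

lemma between_between (θ : N.Params) (y : Y) {l k m : ℕ} (h : l ≤ k) (h' : k ≤ m)
    (F : Vec (N.d m)) :
    N.between θ y l k h (N.between θ y k m h' F) = N.between θ y l m (h.trans h') F := by
  induction m, h' using Nat.le_induction with
  | base => rw [between_self]
  | succ m hm ih => rw [between_succ N θ y hm, ih, ← between_succ N θ y (h.trans hm)]

lemma between_congr {θ θ' : N.Params} (y : Y) {l k : ℕ} (h : l ≤ k)
    (hθ : ∀ j, 1 ≤ j → l ≤ j → j < k → θ j = θ' j) :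
    N.between θ y l k h = N.between θ' y l k h := by
  induction k, h using Nat.le_induction with
  | base =>
    funext F
    rw [between_self, between_self]
  | succ k hk ih =>
    funext F
    rw [between_succ N θ y hk, between_succ N θ' y hk,
      ih fun j h1 h2 h3 => hθ j h1 h2 (h3.trans k.lt_succ_self)]
    congr 1
    cases k with
    | zero => rfl
    | succ k =>
      change N.layer (k + 1) (θ (k + 1)) F = N.layer (k + 1) (θ' (k + 1)) F
      rw [hθ (k + 1) (by omega) hk (by omega)]

lemma between_value (θ : N.Params) (x : Vec (N.d (N.L + 1))) (y : Y) {l k : ℕ} (h : l ≤ k)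
    (hk : k ≤ N.L + 1) :
    N.between θ y l k h (N.value θ x y k hk) = N.value θ x y l (h.trans hk) :=
  N.between_between θ y h hk x

lemma layerMap_value (θ : N.Params) (x : Vec (N.d (N.L + 1))) (y : Y) {k : ℕ} (hk : k ≤ N.L) :
    N.layerMap θ y k (N.value θ x y (k + 1) (by omega)) = N.value θ x y k (by omega) := by
  rw [← N.between_value θ x y k.le_succ (by omega), between_succ_self]

lemma value_eq_layer (θ' : N.Params) {k : ℕ} (hk1 : 1 ≤ k) (hk : k ≤ N.L) :
    N.value θ' x y k (hk.trans N.L.le_succ)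
      = N.layer k (θ' k) (N.value θ' x y (k + 1) (Nat.succ_le_succ hk)) := by
  obtain ⟨k, rfl⟩ := Nat.exists_eq_add_of_le' hk1
  exact (N.layerMap_value θ' x y hk).symm

lemma value_top (θ : N.Params) (x : Vec (N.d (N.L + 1))) (y : Y) :
    N.value θ x y (N.L + 1) le_rfl = x :=
  N.between_self θ y _ x

/-! ### Smoothness and measurability of compositions of layers -/

lemma differentiableAt_between (θ : N.Params) (y : Y) {l k : ℕ} (h : l ≤ k) {F : Vec (N.d k)}
    (hd : ∀ j (hj : j < k), l ≤ j →
      DifferentiableAt ℝ (N.layerMap θ y j) (N.between θ y (j + 1) k hj F)) :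
    DifferentiableAt ℝ (N.between θ y l k h) F := by
  induction k, h using Nat.le_induction with
  | base =>
    rw [show N.between θ y l l le_rfl = id from funext (N.between_self θ y l)]
    exact differentiableAt_id
  | succ k hk ih =>
    rw [show N.between θ y l (k + 1) (hk.trans k.le_succ)
      = N.between θ y l k hk ∘ N.layerMap θ y k from funext (N.between_succ θ y hk)]
    have hk' := hd k k.lt_succ_self hk
    rw [between_self] at hk'
    refine DifferentiableAt.comp F (ih fun j hj hlj => ?_) hk'
    rw [← N.between_succ θ y hj]
    exact hd j (by omega) hlj

lemma measurable_between {y : Y} (hm : ∀ j, j ≤ N.L →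
      Measurable fun q : N.Params × Vec (N.d (j + 1)) => N.layerMap q.1 y j q.2)
    {l k : ℕ} (h : l ≤ k) (hk : k ≤ N.L + 1) :
    Measurable fun q : N.Params × Vec (N.d k) => N.between q.1 y l k h q.2 := by
  induction k, h using Nat.le_induction with
  | base =>
    simp only [between_self]
    exact measurable_snd
  | succ k hk' ih =>
    simp only [N.between_succ _ y hk']
    exact (ih (by omega)).comp (measurable_fst.prodMk (hm k (by omega)))

/-- The Jacobian of `f_l` with respect to `f_k` as a function of the value `F` of `f_k`, in units of
the length of `f_l`. It is `0` if `f_l = 0`, and it is written with `quotientDeriv` in order to be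
jointly measurable in `θ` and `F`. -/
@[irreducible]
def relJacobian (θ : N.Params) (y : Y) (l k : ℕ) (h : l ≤ k) (F : Vec (N.d k)) :
    Vec (N.d k) →L[ℝ] Vec (N.d l) :=
  ‖N.between θ y l k h F‖⁻¹ • quotientDeriv (N.between θ y l k h) F

lemma measurable_relJacobian {y : Y} (hm : ∀ j, j ≤ N.L →
      Measurable fun q : N.Params × Vec (N.d (j + 1)) => N.layerMap q.1 y j q.2)
    {l k : ℕ} (h : l ≤ k) (hk : k ≤ N.L + 1) :
    Measurable fun q : N.Params × Vec (N.d k) => N.relJacobian q.1 y l k h q.2 := by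
  unfold relJacobian
  have hb := N.measurable_between hm h hk
  have hq := measurable_quotientDeriv (g := fun θ => N.between θ y l k h) hb
  exact Measurable.smul (f := fun q : N.Params × Vec (N.d k) => ‖N.between q.1 y l k h q.2‖⁻¹)
    hb.norm.inv hq

/-! ### Independence of the layers -/

/-- The parameter vector with all sub-vectors outside the index set `s` replaced by `0`. -/
def restrictParams (s : Finset ℕ) (θ : N.Params) : N.Params :=
  fun l => if l ∈ s then θ l else 0

lemma restrictParams_apply {s : Finset ℕ} {θ : N.Params} {l : ℕ} (hl : l ∈ s) :
    N.restrictParams s θ l = θ l :=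
  if_pos hl

lemma between_restrictParams (θ : N.Params) (y : Y) {l k : ℕ} (h : l ≤ k) :
    N.between (N.restrictParams (Finset.Ico 1 k) θ) y l k h = N.between θ y l k h :=
  N.between_congr y h fun _ h1 _ h3 =>
    N.restrictParams_apply (Finset.mem_Ico.2 ⟨h1, h3⟩)

lemma relJacobian_restrictParams (θ : N.Params) (y : Y) {l k : ℕ} (h : l ≤ k) :
    N.relJacobian (N.restrictParams (Finset.Ico 1 k) θ) y l k h = N.relJacobian θ y l k h := by
  funext F
  rw [relJacobian, between_restrictParams, relJacobian]

lemma value_restrictParams (θ : N.Params) (x : Vec (N.d (N.L + 1))) (y : Y) {m k : ℕ}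
    (hmk : m ≤ k) (hk : k ≤ N.L + 1) :
    N.value (N.restrictParams (Finset.Ico m (N.L + 1)) θ) x y k hk = N.value θ x y k hk :=
  congrFun (N.between_congr y hk fun _ _ h2 h3 =>
    N.restrictParams_apply (Finset.mem_Ico.2 ⟨hmk.trans h2, h3⟩)) x

section

variable {Ω : Type*} [MeasurableSpace Ω] {μ : Measure Ω} {θ : Ω → N.Params}

lemma measurable_restrictParams (hθ : ∀ l, 1 ≤ l → l ≤ N.L → Measurable fun ω => θ ω l)
    {s : Finset ℕ} (hs : ∀ l ∈ s, 1 ≤ l ∧ l ≤ N.L) :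
    Measurable fun ω => N.restrictParams s (θ ω) := by
  refine measurable_pi_iff.2 fun l => ?_
  by_cases hl : l ∈ s
  · simp only [restrictParams, if_pos hl]
    exact hθ l (hs l hl).1 (hs l hl).2
  · simp only [restrictParams, if_neg hl]
    exact measurable_const

lemma indepFun_restrictParams (hθ : ∀ l, 1 ≤ l → l ≤ N.L → Measurable fun ω => θ ω l)
    (hind : iIndepFun (fun (i : Fin N.L) (ω : Ω) => θ ω (i + 1)) μ) {s t : Finset ℕ}
    (hs : ∀ l ∈ s, 1 ≤ l ∧ l ≤ N.L) (ht : ∀ l ∈ t, 1 ≤ l ∧ l ≤ N.L) (hst : Disjoint s t) :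
    IndepFun (fun ω => N.restrictParams s (θ ω)) (fun ω => N.restrictParams t (θ ω)) μ := by
  let I : Finset ℕ → Finset (Fin N.L) := fun s => Finset.univ.filter fun i => (i : ℕ) + 1 ∈ s
  -- `G s` reassembles a restricted parameter vector from its sub-vectors
  let G : (s : Finset ℕ) → ((i : I s) → Vec (N.p (i + 1))) → N.Params := fun s g l =>
    match l with
    | 0 => 0
    | l + 1 => if h : ∃ _ : l < N.L, l + 1 ∈ s then
        g ⟨⟨l, h.1⟩, Finset.mem_filter.2 ⟨Finset.mem_univ _, h.2⟩⟩ else 0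
  have hG : ∀ s, Measurable (G s) := by
    intro s
    refine measurable_pi_iff.2 fun l => ?_
    cases l with
    | zero => exact measurable_const
    | succ l =>
      by_cases h : ∃ _ : l < N.L, l + 1 ∈ s
      · simp only [G, dif_pos h]
        exact measurable_pi_apply
          (⟨⟨l, h.1⟩, Finset.mem_filter.2 ⟨Finset.mem_univ _, h.2⟩⟩ : I s)
      · simp only [G, dif_neg h]
        exact measurable_const
  have hGr : ∀ s : Finset ℕ, (∀ l ∈ s, 1 ≤ l ∧ l ≤ N.L) →
      (fun ω => N.restrictParams s (θ ω)) = fun ω => G s fun i => θ ω (i + 1) := by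
    intro s hs
    funext ω l
    cases l with
    | zero => exact if_neg fun h => by have := hs 0 h; omega
    | succ l =>
      by_cases hl : l + 1 ∈ s
      · have h : ∃ _ : l < N.L, l + 1 ∈ s := ⟨by have := hs _ hl; omega, hl⟩
        simp only [G, dif_pos h, restrictParams, if_pos hl]
      · have h : ¬ ∃ _ : l < N.L, l + 1 ∈ s := fun h => hl h.2
        simp only [G, dif_neg h, restrictParams, if_neg hl]
  have hdisj : Disjoint (I s) (I t) := by
    refine Finset.disjoint_left.2 fun i hi hi' => ?_
    exact Finset.disjoint_left.1 hst (Finset.mem_filter.1 hi).2 (Finset.mem_filter.1 hi').2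
  have := hind.indepFun_finset (I s) (I t) hdisj fun i => hθ _ (by omega) (by omega)
  rw [hGr s hs, hGr t ht]
  exact this.comp (hG s) (hG t)

end

end NeuralNetwork

/-! ### Networks with independent, uniformly distributed layers -/

namespace NeuralNetwork

variable {Y : Type*} (N : NeuralNetwork Y)

/-- The random network at a fixed datapoint: the sub-vectors of `θ` are independent, and each layer
`1 ≤ l ≤ L` satisfies its `LayerCondition` on a set that contains the value of layer `l + 1`,
provided that this value has the length `c (l + 1)` when `l < L`. This form does not distinguish
the layer that reads the data input from the others. -/
structure IsLayerwiseUniform {Ω : Type*} [MeasurableSpace Ω] (μ : Measure Ω)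
    [IsProbabilityMeasure μ] (θ : Ω → N.Params) (c : ℕ → ℝ) (x : Vec (N.d (N.L + 1))) (y : Y) :
    Prop where
  measurable_param : ∀ l, 1 ≤ l → l ≤ N.L → Measurable fun ω => θ ω l
  indep : iIndepFun (fun (i : Fin N.L) (ω : Ω) => θ ω (i + 1)) μ
  two_le_width : ∀ l, 1 ≤ l → l ≤ N.L + 1 → 2 ≤ N.d l
  length_pos : ∀ l, 1 ≤ l → l ≤ N.L → 0 < c l
  layer : ∀ l, 1 ≤ l → ∀ hl : l ≤ N.L, ∃ S, N.LayerCondition μ l (fun ω => θ ω l) (c l) S ∧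
    ∀ θ' : N.Params, (l < N.L → ‖N.value θ' x y (l + 1) (Nat.succ_le_succ hl)‖ = c (l + 1)) →
      N.value θ' x y (l + 1) (Nat.succ_le_succ hl) ∈ S
  measurable_err : Measurable (N.err y)
  differentiable_err : ∀ F, ‖F‖ = c 1 → DifferentiableAt ℝ (N.err y) F

namespace IsLayerwiseUniform

variable {N} {Ω : Type*} [MeasurableSpace Ω] {μ : Measure Ω} [IsProbabilityMeasure μ]
  {θ : Ω → N.Params} {c : ℕ → ℝ} {x : Vec (N.d (N.L + 1))} {y : Y}

lemma measurable_layerMap (H : N.IsLayerwiseUniform μ θ c x y) {j : ℕ} (hj : j ≤ N.L) :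
    Measurable fun q : N.Params × Vec (N.d (j + 1)) => N.layerMap q.1 y j q.2 := by
  cases j with
  | zero => exact H.measurable_err.comp measurable_snd
  | succ j =>
    obtain ⟨S, hS, -⟩ := H.layer (j + 1) (by omega) hj
    have hp : Measurable fun q : N.Params × Vec (N.d (j + 1 + 1)) => (q.1 (j + 1), q.2) :=
      ((measurable_pi_apply (j + 1)).comp measurable_fst).prodMk measurable_snd
    exact hS.measurable.comp hp

lemma measurable_lower (H : N.IsLayerwiseUniform μ θ c x y) {k : ℕ} (hk : k ≤ N.L + 1) :
    Measurable fun ω => N.restrictParams (Finset.Ico 1 k) (θ ω) :=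
  N.measurable_restrictParams H.measurable_param fun l hl => by
    rw [Finset.mem_Ico] at hl
    omega

lemma measurable_upper (H : N.IsLayerwiseUniform μ θ c x y) {k : ℕ} (hk : 1 ≤ k) :
    Measurable fun ω => N.restrictParams (Finset.Ico k (N.L + 1)) (θ ω) :=
  N.measurable_restrictParams H.measurable_param fun l hl => by
    rw [Finset.mem_Ico] at hl
    omega

lemma indepFun_lower_upper (H : N.IsLayerwiseUniform μ θ c x y)
    {k : ℕ} (hk1 : 1 ≤ k) (hk : k ≤ N.L + 1) :
    IndepFun (fun ω => N.restrictParams (Finset.Ico 1 k) (θ ω))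
      (fun ω => N.restrictParams (Finset.Ico k (N.L + 1)) (θ ω)) μ := by
  refine N.indepFun_restrictParams H.measurable_param H.indep (fun l hl => ?_) (fun l hl => ?_)
    (Finset.Ico_disjoint_Ico_consecutive 1 k (N.L + 1)) <;>
  · rw [Finset.mem_Ico] at hl
    omega

lemma measurable_value_params (H : N.IsLayerwiseUniform μ θ c x y) {k : ℕ} (hk : k ≤ N.L + 1) :
    Measurable fun θ' : N.Params => N.value θ' x y k hk :=
  (N.measurable_between (fun _ hj => H.measurable_layerMap hj) hk le_rfl).comp
    (measurable_id.prodMk measurable_const)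

lemma measurable_value (H : N.IsLayerwiseUniform μ θ c x y)
    {k : ℕ} (hk1 : 1 ≤ k) (hk : k ≤ N.L + 1) :
    Measurable fun ω => N.value (θ ω) x y k hk := by
  have h := (H.measurable_value_params hk).comp (H.measurable_upper hk1)
  simp only [Function.comp_def, N.value_restrictParams _ x y le_rfl hk] at h
  exact h

/-- The input of a layer depends on the parameters of the layers above it only. -/
lemma indepFun_value_param (H : N.IsLayerwiseUniform μ θ c x y)
    {k : ℕ} (hk1 : 1 ≤ k) (hk : k ≤ N.L) :
    IndepFun (fun ω => N.value (θ ω) x y (k + 1) (Nat.succ_le_succ hk)) (fun ω => θ ω k) μ := by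
  have h := ((H.indepFun_lower_upper (k := k + 1) (by omega) (by omega)).comp
    (measurable_pi_apply k) (H.measurable_value_params (k := k + 1) (by omega))).symm
  simp only [Function.comp_def, N.value_restrictParams _ x y le_rfl,
    N.restrictParams_apply (s := Finset.Ico 1 (k + 1)) (l := k)
      (Finset.mem_Ico.2 ⟨hk1, k.lt_succ_self⟩)] at h
  exact h

/-- Every inner layer value is a uniformly random vector of its length: conditionally on the input
of the layer this is the assumption, with a law that does not depend on the input. -/
lemma map_value (H : N.IsLayerwiseUniform μ θ c x y) {k : ℕ} (hk1 : 1 ≤ k) (hk : k ≤ N.L) :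
    μ.map (fun ω => N.value (θ ω) x y k (hk.trans N.L.le_succ)) = uniformLength (N.d k) (c k) := by
  induction hn : N.L - k using Nat.strong_induction_on generalizing k with
  | _ n ih =>
  obtain ⟨S, hS, hmem⟩ := H.layer k hk1 hk
  have hS' : ∀ᵐ ω ∂μ, N.value (θ ω) x y (k + 1) (Nat.succ_le_succ hk) ∈ S := by
    by_cases hkL : k < N.L
    · have h1 := ae_norm_uniformLength (n := N.d (k + 1)) (H.length_pos (k + 1) (by omega) hkL)
      rw [← ih (N.L - (k + 1)) (by omega) (by omega) hkL rfl] at h1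
      filter_upwards [ae_of_ae_map (H.measurable_value (by omega) _).aemeasurable h1] with ω hω
      exact hmem _ fun _ => hω
    · exact Filter.Eventually.of_forall fun ω => hmem _ fun h => absurd h hkL
  have hX := H.measurable_value (k := k + 1) (by omega) (Nat.succ_le_succ hk)
  have hY := H.measurable_param k hk1 hk
  ext s hs
  rw [Measure.map_apply (H.measurable_value hk1 _) hs, ← lintegral_indicator_one
    (H.measurable_value hk1 _ hs)]
  have hg : Measurable fun q : Vec (N.d (k + 1)) × Vec (N.p k) =>
      s.indicator (1 : Vec (N.d k) → ℝ≥0∞) (N.layer k q.2 q.1) :=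
    (measurable_one.indicator hs).comp (hS.measurable.comp measurable_swap)
  have hcalc := lintegral_of_indepFun (H.indepFun_value_param hk1 hk) hX hY hg
  have hinner : ∀ᵐ ω ∂μ, ∫⁻ ω', s.indicator (1 : Vec (N.d k) → ℝ≥0∞)
      (N.layer k (θ ω' k) (N.value (θ ω) x y (k + 1) (Nat.succ_le_succ hk))) ∂μ
      = uniformLength (N.d k) (c k) s := by
    filter_upwards [hS'] with ω hω
    rw [← hS.uniform _ hω, ← lintegral_indicator_one hs,
      lintegral_map (measurable_one.indicator hs)]
    exact hS.measurable.comp (hY.prodMk measurable_const)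
  rw [lintegral_congr_ae hinner, lintegral_const, measure_univ, mul_one] at hcalc
  rw [← hcalc]
  refine lintegral_congr fun ω => ?_
  dsimp only
  rw [← N.value_eq_layer (θ ω) hk1 hk]
  rfl

lemma ae_norm_value (H : N.IsLayerwiseUniform μ θ c x y) {k : ℕ} (hk1 : 1 ≤ k) (hk : k ≤ N.L) :
    ∀ᵐ ω ∂μ, ‖N.value (θ ω) x y k (hk.trans N.L.le_succ)‖ = c k := by
  have h1 := ae_norm_uniformLength (n := N.d k) (H.length_pos k hk1 hk)
  rw [← H.map_value hk1 hk] at h1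
  exact ae_of_ae_map (H.measurable_value hk1 _).aemeasurable h1

lemma exists_norm_value (H : N.IsLayerwiseUniform μ θ c x y)
    {k : ℕ} (hk1 : 1 ≤ k) (hk : k ≤ N.L + 1) :
    ∃ r, ∀ᵐ ω ∂μ, ‖N.value (θ ω) x y k hk‖ = r := by
  rcases Nat.lt_or_eq_of_le hk with h | rfl
  · exact ⟨c k, H.ae_norm_value hk1 (Nat.le_of_lt_succ h)⟩
  · exact ⟨‖x‖, Filter.Eventually.of_forall fun ω => by rw [value_top]⟩

lemma exists_layerCondition (H : N.IsLayerwiseUniform μ θ c x y)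
    {k : ℕ} (hk1 : 1 ≤ k) (hk : k ≤ N.L) :
    ∃ S, N.LayerCondition μ k (fun ω => θ ω k) (c k) S ∧
      ∀ᵐ ω ∂μ, N.value (θ ω) x y (k + 1) (Nat.succ_le_succ hk) ∈ S := by
  obtain ⟨S, hS, hmem⟩ := H.layer k hk1 hk
  refine ⟨S, hS, ?_⟩
  by_cases hkL : k < N.L
  · filter_upwards [H.ae_norm_value (k := k + 1) (by omega) hkL] with ω hω
    exact hmem _ fun _ => hω
  · exact Filter.Eventually.of_forall fun ω => hmem _ fun h => absurd h hkL

lemma ae_differentiableAt_layerMap (H : N.IsLayerwiseUniform μ θ c x y)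
    : ∀ᵐ ω ∂μ, ∀ j (hj : j ≤ N.L),
    DifferentiableAt ℝ (N.layerMap (θ ω) y j)
      (N.value (θ ω) x y (j + 1) (Nat.succ_le_succ hj)) := by
  refine ae_all_iff.2 fun j => ?_
  by_cases hj : j ≤ N.L
  swap
  · exact Filter.Eventually.of_forall fun ω h => absurd h hj
  cases j with
  | zero =>
    filter_upwards [H.ae_norm_value le_rfl N.one_le_L] with ω hω _
    exact H.differentiable_err _ hω
  | succ j =>
    obtain ⟨S, hS, hmem⟩ := H.exists_layerCondition (by omega) hj
    filter_upwards [hS.differentiable, hmem] with ω h1 h2 _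
    exact h1 _ h2

lemma ae_differentiableAt_between (H : N.IsLayerwiseUniform μ θ c x y)
    : ∀ᵐ ω ∂μ, ∀ l k (h : l ≤ k) (hk : k ≤ N.L + 1),
    DifferentiableAt ℝ (N.between (θ ω) y l k h) (N.value (θ ω) x y k hk) := by
  filter_upwards [H.ae_differentiableAt_layerMap] with ω hω l k h hk
  refine N.differentiableAt_between (θ ω) y h fun j hj _ => ?_
  rw [N.between_value (θ ω) x y hj hk]
  exact hω j (by omega)

/-- The chain rule along the layer values of the random network. -/
lemma ae_quotientDeriv_succ (H : N.IsLayerwiseUniform μ θ c x y)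
    {l k : ℕ} (h : l ≤ k) (hk : k ≤ N.L) : ∀ᵐ ω ∂μ,
    quotientDeriv (N.between (θ ω) y l (k + 1) (h.trans k.le_succ))
        (N.value (θ ω) x y (k + 1) (Nat.succ_le_succ hk))
      = quotientDeriv (N.between (θ ω) y l k h) (N.value (θ ω) x y k (hk.trans N.L.le_succ)) ∘L
        quotientDeriv (N.layerMap (θ ω) y k)
          (N.value (θ ω) x y (k + 1) (Nat.succ_le_succ hk)) := by
  filter_upwards [H.ae_differentiableAt_layerMap, H.ae_differentiableAt_between] with ω h1 h2
  rw [quotientDeriv_eq_fderiv (h2 l (k + 1) _ _), quotientDeriv_eq_fderiv (h2 l k h _),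
    quotientDeriv_eq_fderiv (h1 k hk),
    show N.between (θ ω) y l (k + 1) (h.trans k.le_succ)
      = N.between (θ ω) y l k h ∘ N.layerMap (θ ω) y k from funext (N.between_succ (θ ω) y h)]
  have h3 := h2 l k h (hk.trans N.L.le_succ)
  rw [← N.layerMap_value (θ ω) x y hk] at h3 ⊢
  exact fderiv_comp _ h3 (h1 k hk)

/-- Layers are invariant to the scale of their inputs, in the infinitesimal sense. -/
lemma ae_quotientDeriv_layerMap_value (H : N.IsLayerwiseUniform μ θ c x y) {j : ℕ} (hj : j < N.L)
    (hscale : j = 0 → ∀ F, ‖F‖ = c 1 → HasDerivAt (fun a : ℝ => N.err y (a • F)) 0 1) :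
    ∀ᵐ ω ∂μ, quotientDeriv (N.layerMap (θ ω) y j)
      (N.value (θ ω) x y (j + 1) (Nat.succ_le_succ hj.le))
      (N.value (θ ω) x y (j + 1) (Nat.succ_le_succ hj.le)) = 0 := by
  cases j with
  | zero =>
    filter_upwards [H.ae_norm_value le_rfl N.one_le_L, H.ae_differentiableAt_layerMap] with ω h1 h2
    rw [quotientDeriv_eq_fderiv (h2 0 hj.le)]
    exact fderiv_apply_self_eq_zero (h2 0 hj.le) (hscale rfl _ h1)
  | succ j =>
    obtain ⟨S, hS, hmem⟩ := H.exists_layerCondition (k := j + 1) (by omega) hj.le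
    have hmeas : Measurable fun q : Vec (N.d (j + 1 + 1)) × Vec (N.p (j + 1)) =>
        quotientDeriv (N.layer (j + 1) q.2) q.1 q.1 :=
      measurable_clm_apply ((measurable_quotientDeriv hS.measurable).comp measurable_swap)
        measurable_fst
    have hset : MeasurableSet {q : Vec (N.d (j + 1 + 1)) × Vec (N.p (j + 1)) |
        quotientDeriv (N.layer (j + 1) q.2) q.1 q.1 = 0} :=
      measurableSet_eq_fun hmeas measurable_const
    have hiff := ae_iff_of_indepFun (H.indepFun_value_param (k := j + 1) (by omega) hj.le)
      (H.measurable_value (by omega) _) (H.measurable_param _ (by omega) hj.le) hset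
    simp only [Set.mem_ofPred_eq] at hiff
    refine hiff.2 ?_
    filter_upwards [hmem] with ω hω
    filter_upwards [hS.differentiable, hS.scale _ hω] with ω' h1 h2
    rw [quotientDeriv_eq_fderiv (h1 _ hω)]
    exact fderiv_apply_self_eq_zero (h1 _ hω) h2

/-- By the chain rule, scale invariance passes from a layer to all layers below it. -/
lemma ae_relJacobian_value (H : N.IsLayerwiseUniform μ θ c x y) {l k : ℕ} (h : l < k) (hk : k ≤ N.L)
    (hscale : l = 0 → ∀ F, ‖F‖ = c 1 → HasDerivAt (fun a : ℝ => N.err y (a • F)) 0 1) :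
    ∀ᵐ ω ∂μ, N.relJacobian (θ ω) y l k h.le (N.value (θ ω) x y k (hk.trans N.L.le_succ))
      (N.value (θ ω) x y k (hk.trans N.L.le_succ)) = 0 := by
  obtain ⟨j, rfl⟩ := Nat.exists_eq_add_of_lt h
  have hlj : l ≤ l + j := Nat.le_add_right l j
  filter_upwards [H.ae_quotientDeriv_succ hlj (by omega),
    H.ae_quotientDeriv_layerMap_value (j := l + j) (by omega)
      fun h0 => hscale (by omega)] with ω h1 h2
  rw [relJacobian, _root_.smul_apply, h1, ContinuousLinearMap.comp_apply, h2,
    map_zero, smul_zero]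

/-- `lintegral_frobSq_comp` holds for each fixed value of the layer's input, and in it the factor
that involves `A` is the same for all of these; so it also holds for the random input. -/
lemma lintegral_frobSq_comp_layer (H : N.IsLayerwiseUniform μ θ c x y)
    {k r : ℕ} (hk1 : 1 ≤ k) (hk : k ≤ N.L)
    {A : Vec (N.d k) → Vec (N.d k) →L[ℝ] Vec r} (hA : Measurable A)
    (hA0 : ∀ᵐ ω ∂μ, A (N.value (θ ω) x y k (hk.trans N.L.le_succ))
      (N.value (θ ω) x y k (hk.trans N.L.le_succ)) = 0) :
    ∫⁻ ω, ENNReal.ofReal (frobSq (A (N.value (θ ω) x y k (hk.trans N.L.le_succ)) ∘L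
        quotientDeriv (N.layerMap (θ ω) y k)
          (N.value (θ ω) x y (k + 1) (Nat.succ_le_succ hk)))) ∂μ
      = (∫⁻ ω, ENNReal.ofReal (frobSq (A (N.value (θ ω) x y k (hk.trans N.L.le_succ)))) ∂μ)
          / ENNReal.ofReal ((N.d k : ℝ) - 1)
        * ∫⁻ ω, ENNReal.ofReal (frobSq (quotientDeriv (N.layerMap (θ ω) y k)
            (N.value (θ ω) x y (k + 1) (Nat.succ_le_succ hk)))) ∂μ := by
  obtain ⟨S, hS, hmem⟩ := H.exists_layerCondition hk1 hk
  have hX := H.measurable_value (k := k + 1) (by omega) (Nat.succ_le_succ hk)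
  have hY := H.measurable_param k hk1 hk
  have hind := H.indepFun_value_param hk1 hk
  have hmap : ∀ θ' : N.Params, N.layerMap θ' y k = N.layer k (θ' k) := by
    obtain ⟨j, rfl⟩ := Nat.exists_eq_add_of_le' hk1
    exact fun θ' => rfl
  have hlay : Measurable fun q : Vec (N.d (k + 1)) × Vec (N.p k) => N.layer k q.2 q.1 :=
    hS.measurable.comp measurable_swap
  have hder : Measurable fun q : Vec (N.d (k + 1)) × Vec (N.p k) =>
      quotientDeriv (N.layer k q.2) q.1 :=
    (measurable_quotientDeriv hS.measurable).comp measurable_swap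
  have hfA : Measurable fun v => ENNReal.ofReal (frobSq (A v)) := measurable_frobSq.comp hA
  have hgB : Measurable fun q : Vec (N.d (k + 1)) × Vec (N.p k) =>
      ENNReal.ofReal (frobSq (quotientDeriv (N.layer k q.2) q.1)) := measurable_frobSq.comp hder
  have hgAB : Measurable fun q : Vec (N.d (k + 1)) × Vec (N.p k) =>
      ENNReal.ofReal (frobSq (A (N.layer k q.2 q.1) ∘L quotientDeriv (N.layer k q.2) q.1)) :=
    measurable_frobSq.comp (measurable_clm_comp (hA.comp hlay) hder)
  have hval : ∀ ω, N.value (θ ω) x y k (hk.trans N.L.le_succ)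
      = N.layer k (θ ω k) (N.value (θ ω) x y (k + 1) (Nat.succ_le_succ hk)) := fun ω =>
    N.value_eq_layer (θ ω) hk1 hk
  have hset : MeasurableSet {v | A v v = 0} :=
    measurableSet_eq_fun (measurable_clm_apply hA measurable_id) measurable_const
  have hA0' : ∀ᵐ v ∂(uniformLength (N.d k) (c k)), A v v = 0 := by
    rw [← H.map_value hk1 hk]
    exact (ae_map_iff (H.measurable_value hk1 _).aemeasurable hset).2 hA0
  have hIA : ∫⁻ ω, ENNReal.ofReal (frobSq (A (N.value (θ ω) x y k (hk.trans N.L.le_succ)))) ∂μ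
      = ∫⁻ v, ENNReal.ofReal (frobSq (A v)) ∂(uniformLength (N.d k) (c k)) := by
    rw [← H.map_value hk1 hk, lintegral_map hfA (H.measurable_value hk1 _)]
  have hinner : ∀ᵐ ω ∂μ, ∫⁻ ω', ENNReal.ofReal (frobSq (A (N.layer k (θ ω' k)
          (N.value (θ ω) x y (k + 1) (Nat.succ_le_succ hk))) ∘L
        quotientDeriv (N.layer k (θ ω' k)) (N.value (θ ω) x y (k + 1) (Nat.succ_le_succ hk)))) ∂μ
      = (∫⁻ v, ENNReal.ofReal (frobSq (A v)) ∂(uniformLength (N.d k) (c k)))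
          / ENNReal.ofReal ((N.d k : ℝ) - 1)
        * ∫⁻ ω', ENNReal.ofReal (frobSq (quotientDeriv (N.layer k (θ ω' k))
          (N.value (θ ω) x y (k + 1) (Nat.succ_le_succ hk)))) ∂μ := by
    filter_upwards [hmem] with ω hω
    set F := N.value (θ ω) x y (k + 1) (Nat.succ_le_succ hk)
    have hf : Measurable fun ω' => N.layer k (θ ω' k) F :=
      hlay.comp (measurable_const.prodMk hY)
    have hB : Measurable fun ω' => quotientDeriv (N.layer k (θ ω' k)) F :=
      hder.comp (measurable_const.prodMk hY)
    have hunif := hS.uniform F hω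
    rw [lintegral_frobSq_comp (f := fun ω' => N.layer k (θ ω' k) F)
      (B := fun ω' => quotientDeriv (N.layer k (θ ω' k)) F)
      (H.two_le_width k hk1 (hk.trans N.L.le_succ)) hf hB (H.length_pos k hk1 hk)
      hunif ?_ hA ?_]
    · rw [← hunif, lintegral_map hfA hf]
    · intro U hU
      obtain ⟨ℓ, u, hℓ, hu, hJ, hrest⟩ := hS.jacobian_apply F hω U hU
      refine ⟨ℓ, u, hℓ, hu, ?_, hrest⟩
      filter_upwards [hJ, hS.differentiable] with ω' h1 h2
      rw [quotientDeriv_eq_fderiv (h2 F hω), h1]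
    · rw [← hunif] at hA0'
      exact ae_of_ae_map hf.aemeasurable hA0'
  rw [hIA]
  simp only [hmap, hval]
  rw [lintegral_of_indepFun hind hX hY hgAB, lintegral_of_indepFun hind hX hY hgB,
    lintegral_congr_ae hinner, lintegral_const_mul]
  exact (hgB.comp ((hX.comp measurable_fst).prodMk (hY.comp measurable_snd))).lintegral_prod_right'

/-- The multiplicative recursion: the Jacobian of the layers below `k` depends on the parameters
of these layers and on `f_k` only, so that one may condition on the former and pass through layer
`k`. -/
lemma lintegral_relJacobian_succ (H : N.IsLayerwiseUniform μ θ c x y)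
    {l k : ℕ} (h : l < k) (hk : k ≤ N.L)
    (hscale : l = 0 → ∀ F, ‖F‖ = c 1 → HasDerivAt (fun a : ℝ => N.err y (a • F)) 0 1) :
    ∫⁻ ω, ENNReal.ofReal (frobSq (N.relJacobian (θ ω) y l (k + 1) (h.le.trans k.le_succ)
        (N.value (θ ω) x y (k + 1) (Nat.succ_le_succ hk)))) ∂μ
      = (∫⁻ ω, ENNReal.ofReal (frobSq (N.relJacobian (θ ω) y l k h.le
          (N.value (θ ω) x y k (hk.trans N.L.le_succ)))) ∂μ)
          / ENNReal.ofReal ((N.d k : ℝ) - 1)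
        * ∫⁻ ω, ENNReal.ofReal (frobSq (quotientDeriv (N.layerMap (θ ω) y k)
            (N.value (θ ω) x y (k + 1) (Nat.succ_le_succ hk)))) ∂μ := by
  have hk1 : 1 ≤ k := by omega
  have hkL : k ≤ N.L + 1 := hk.trans N.L.le_succ
  have hX := H.measurable_lower hkL
  have hY := H.measurable_upper hk1
  have hind := H.indepFun_lower_upper hk1 hkL
  have hJ := N.measurable_relJacobian (fun _ hj => H.measurable_layerMap hj) h.le hkL
  have hv := H.measurable_value_params hkL
  have hA : Measurable fun q : N.Params × N.Params =>
      N.relJacobian q.1 y l k h.le (N.value q.2 x y k hkL) :=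
    hJ.comp (measurable_fst.prodMk (hv.comp measurable_snd))
  have hB : Measurable fun q : N.Params × N.Params => quotientDeriv (N.layerMap q.2 y k)
      (N.value q.2 x y (k + 1) (Nat.succ_le_succ hk)) :=
    ((measurable_quotientDeriv (g := fun θ' => N.layerMap θ' y k) (H.measurable_layerMap hk)).comp
      (measurable_id.prodMk (H.measurable_value_params (Nat.succ_le_succ hk)))).comp measurable_snd
  have hlm : ∀ θ' : N.Params,
      N.layerMap (N.restrictParams (Finset.Ico k (N.L + 1)) θ') y k = N.layerMap θ' y k := by
    intro θ'
    rw [← between_succ_self, ← between_succ_self]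
    exact N.between_congr y _ fun j _ h2 h3 =>
      N.restrictParams_apply (Finset.mem_Ico.2 ⟨h2, by omega⟩)
  have hchain : ∀ᵐ ω ∂μ, N.relJacobian (θ ω) y l (k + 1) (h.le.trans k.le_succ)
        (N.value (θ ω) x y (k + 1) (Nat.succ_le_succ hk))
      = N.relJacobian (θ ω) y l k h.le (N.value (θ ω) x y k hkL) ∘L
        quotientDeriv (N.layerMap (θ ω) y k)
          (N.value (θ ω) x y (k + 1) (Nat.succ_le_succ hk)) := by
    filter_upwards [H.ae_quotientDeriv_succ h.le hk] with ω hω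
    rw [relJacobian, relJacobian, hω, between_value, between_value,
      ContinuousLinearMap.smul_comp]
  have hsplit1 := lintegral_of_indepFun hind hX hY
    (measurable_frobSq.comp (measurable_clm_comp hA hB))
  have hsplit2 := lintegral_of_indepFun hind hX hY (measurable_frobSq.comp hA)
  have hscale0 : ∀ᵐ ω ∂μ, ∀ᵐ ω' ∂μ, N.relJacobian (θ ω) y l k h.le (N.value (θ ω') x y k hkL)
      (N.value (θ ω') x y k hkL) = 0 := by
    have h0 := H.ae_relJacobian_value h hk hscale
    have hset : MeasurableSet {q : N.Params × N.Params |
        N.relJacobian q.1 y l k h.le (N.value q.2 x y k hkL) (N.value q.2 x y k hkL) = 0} :=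
      measurableSet_eq_fun (measurable_clm_apply hA (hv.comp measurable_snd)) measurable_const
    have hiff := ae_iff_of_indepFun hind hX hY hset
    simp only [Set.mem_ofPred_eq, relJacobian_restrictParams,
      N.value_restrictParams _ x y le_rfl hkL] at hiff
    exact hiff.1 h0
  simp only [Function.comp_apply, relJacobian_restrictParams, hlm,
    N.value_restrictParams _ x y le_rfl hkL,
    N.value_restrictParams _ x y k.le_succ (Nat.succ_le_succ hk)] at hsplit1 hsplit2
  rw [lintegral_congr_ae (hchain.mono fun ω hω => by rw [hω]), hsplit1, hsplit2]
  have hpass : ∀ᵐ ω ∂μ, ∫⁻ ω', ENNReal.ofReal (frobSq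
        (N.relJacobian (θ ω) y l k h.le (N.value (θ ω') x y k hkL) ∘L
        quotientDeriv (N.layerMap (θ ω') y k)
          (N.value (θ ω') x y (k + 1) (Nat.succ_le_succ hk)))) ∂μ
      = (∫⁻ ω', ENNReal.ofReal (frobSq
        (N.relJacobian (θ ω) y l k h.le (N.value (θ ω') x y k hkL))) ∂μ)
          / ENNReal.ofReal ((N.d k : ℝ) - 1)
        * ∫⁻ ω', ENNReal.ofReal (frobSq (quotientDeriv (N.layerMap (θ ω') y k)
            (N.value (θ ω') x y (k + 1) (Nat.succ_le_succ hk)))) ∂μ := by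
    filter_upwards [hscale0] with ω hω
    exact H.lintegral_frobSq_comp_layer hk1 hk (hJ.comp measurable_prodMk_left) hω
  have hmeas : Measurable fun ω => ∫⁻ ω', ENNReal.ofReal (frobSq
      (N.relJacobian (θ ω) y l k h.le (N.value (θ ω') x y k hkL))) ∂μ := by
    have := ((measurable_frobSq.comp hA).comp
      ((hX.comp measurable_fst).prodMk (hY.comp measurable_snd))).lintegral_prod_right' (ν := μ)
    simp only [Function.comp_apply, relJacobian_restrictParams,
      N.value_restrictParams _ x y le_rfl hkL] at this
    exact this
  simp only [div_eq_mul_inv] at hpass ⊢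
  rw [lintegral_congr_ae hpass, lintegral_mul_const _ (hmeas.mul_const _),
    lintegral_mul_const _ hmeas]

/-- The squared gradient scale coefficient in terms of the relative Jacobian. -/
lemma ae_gsc_sq (H : N.IsLayerwiseUniform μ θ c x y)
    {l k : ℕ} (h : l ≤ k) (hk : k ≤ N.L + 1) : ∀ᵐ ω ∂μ,
    N.gsc k l (θ ω) x y ^ 2 = ‖N.value (θ ω) x y k hk‖ ^ 2 / N.d k
      * frobSq (N.relJacobian (θ ω) y l k h (N.value (θ ω) x y k hk)) := by
  filter_upwards [H.ae_differentiableAt_between] with ω hω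
  rw [gsc, dif_pos ⟨h, hk⟩, div_pow, mul_pow, qmNorm_sq, relJacobian, frobSq_smul, jacobian,
    quotientDeriv_eq_fderiv (hω l k h hk), between_value]
  ring

end IsLayerwiseUniform

end NeuralNetwork

/-! ### Gradient scale coefficients -/

/-- The weighted quadratic expectations are square roots of weighted second moments, so that it
suffices to multiply the latter. -/
lemma ofReal_sqrt_mul_quadExp {Ω : Type*} [MeasurableSpace Ω] {μ : Measure Ω} {a : ℝ}
    (ha : 0 ≤ a) (X : Ω → ℝ) :
    ENNReal.ofReal √a * quadExp μ X
      = (ENNReal.ofReal a * ∫⁻ ω, ENNReal.ofReal (X ω ^ 2) ∂μ) ^ (1 / 2 : ℝ) := by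
  rw [ENNReal.mul_rpow_of_nonneg _ _ (by norm_num), quadExp, Real.sqrt_eq_rpow,
    ENNReal.ofReal_rpow_of_nonneg ha (by norm_num)]

namespace NeuralNetwork.IsLayerwiseUniform

variable {Y : Type*} {N : NeuralNetwork Y} {Ω : Type*} [MeasurableSpace Ω] {μ : Measure Ω}
  [IsProbabilityMeasure μ] {θ : Ω → N.Params} {c : ℕ → ℝ} {x : Vec (N.d (N.L + 1))} {y : Y}

lemma lintegral_gsc_sq (H : N.IsLayerwiseUniform μ θ c x y) {l k : ℕ} (h : l ≤ k) (hk1 : 1 ≤ k)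
    (hk : k ≤ N.L + 1) {r : ℝ} (hr : ∀ᵐ ω ∂μ, ‖N.value (θ ω) x y k hk‖ = r) :
    ENNReal.ofReal ((N.d k : ℝ) / ((N.d k : ℝ) - 1))
        * ∫⁻ ω, ENNReal.ofReal (N.gsc k l (θ ω) x y ^ 2) ∂μ
      = ENNReal.ofReal (r ^ 2) / ENNReal.ofReal ((N.d k : ℝ) - 1)
        * ∫⁻ ω, ENNReal.ofReal (frobSq (N.relJacobian (θ ω) y l k h
            (N.value (θ ω) x y k hk))) ∂μ := by
  have hd : (2 : ℝ) ≤ N.d k := by exact_mod_cast H.two_le_width k hk1 hk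
  have hE : ∫⁻ ω, ENNReal.ofReal (N.gsc k l (θ ω) x y ^ 2) ∂μ
      = ENNReal.ofReal (r ^ 2 / N.d k) * ∫⁻ ω, ENNReal.ofReal (frobSq (N.relJacobian (θ ω) y l k h
            (N.value (θ ω) x y k hk))) ∂μ := by
    rw [← lintegral_const_mul' _ _ ENNReal.ofReal_ne_top]
    refine lintegral_congr_ae ?_
    filter_upwards [H.ae_gsc_sq h hk, hr] with ω h1 h2
    rw [h1, h2, ENNReal.ofReal_mul (by positivity)]
  rw [hE, ← mul_assoc, ← ENNReal.ofReal_mul (div_nonneg (by linarith) (by linarith)),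
    ← ENNReal.ofReal_div_of_pos (by linarith)]
  congr 2
  field_simp

/-- The recursion for the normalized expected squares of the gradient scale coefficients. -/
lemma lintegral_gsc_sq_succ (H : N.IsLayerwiseUniform μ θ c x y) {l k : ℕ} (h : l < k)
    (hk : k ≤ N.L)
    (hscale : l = 0 → ∀ F, ‖F‖ = c 1 → HasDerivAt (fun a : ℝ => N.err y (a • F)) 0 1) :
    ENNReal.ofReal ((N.d (k + 1) : ℝ) / ((N.d (k + 1) : ℝ) - 1))
        * ∫⁻ ω, ENNReal.ofReal (N.gsc (k + 1) l (θ ω) x y ^ 2) ∂μ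
      = (ENNReal.ofReal ((N.d k : ℝ) / ((N.d k : ℝ) - 1))
          * ∫⁻ ω, ENNReal.ofReal (N.gsc k l (θ ω) x y ^ 2) ∂μ)
        * (ENNReal.ofReal ((N.d (k + 1) : ℝ) / ((N.d (k + 1) : ℝ) - 1))
          * ∫⁻ ω, ENNReal.ofReal (N.gsc (k + 1) k (θ ω) x y ^ 2) ∂μ) := by
  have hk1 : 1 ≤ k := by omega
  have hc := H.length_pos k hk1 hk
  obtain ⟨r, hr⟩ := H.exists_norm_value (k := k + 1) (by omega) (Nat.succ_le_succ hk)
  have hck := H.ae_norm_value hk1 hk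
  rw [H.lintegral_gsc_sq (h.le.trans k.le_succ) (by omega) _ hr,
    H.lintegral_gsc_sq k.le_succ (by omega) _ hr, H.lintegral_gsc_sq h.le hk1 _ hck,
    H.lintegral_relJacobian_succ h hk hscale]
  have hone : ∫⁻ ω, ENNReal.ofReal (frobSq (N.relJacobian (θ ω) y k (k + 1) k.le_succ
        (N.value (θ ω) x y (k + 1) (Nat.succ_le_succ hk)))) ∂μ
      = ENNReal.ofReal ((c k)⁻¹ ^ 2) * ∫⁻ ω, ENNReal.ofReal (frobSq
          (quotientDeriv (N.layerMap (θ ω) y k)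
            (N.value (θ ω) x y (k + 1) (Nat.succ_le_succ hk)))) ∂μ := by
    rw [← lintegral_const_mul' _ _ ENNReal.ofReal_ne_top]
    refine lintegral_congr_ae ?_
    filter_upwards [hck] with ω hω
    rw [relJacobian, frobSq_smul, between_value, hω, between_succ_self,
      ENNReal.ofReal_mul (by positivity)]
  have hcc : ENNReal.ofReal (c k ^ 2) * ENNReal.ofReal ((c k)⁻¹ ^ 2) = 1 := by
    rw [← ENNReal.ofReal_mul (by positivity), ← mul_pow, mul_inv_cancel₀ hc.ne', one_pow,
      ENNReal.ofReal_one]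
  rw [hone]
  simp only [div_eq_mul_inv]
  generalize ENNReal.ofReal (c k ^ 2) = a at *
  generalize ENNReal.ofReal ((c k)⁻¹ ^ 2) = a' at *
  rw [← one_mul (ENNReal.ofReal (r ^ 2) * _ * _), ← hcc]
  ring

end NeuralNetwork.IsLayerwiseUniform

end

theorem theorem2 {Y : Type*} (N : NeuralNetwork Y)
    {Ω : Type*} [MeasurableSpace Ω] (μ : Measure Ω) [IsProbabilityMeasure μ]
    -- the random parameter, with independent sub-vectors
    (θ : Ω → N.Params)
    (hθ_meas : ∀ l, 1 ≤ l → l ≤ N.L → Measurable (fun ω => θ ω l))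
    (hθ_indep : iIndepFun (fun (i : Fin N.L) (ω : Ω) => θ ω (i + 1)) μ)
    (hd : ∀ l, 1 ≤ l → l ≤ N.L + 1 → 2 ≤ N.d l)
    (c : ℕ → ℝ) (hc : ∀ l, 1 ≤ l → l ≤ N.L → 0 < c l)
    -- the domain of data inputs
    (𝒳 : Set (Vec (N.d (N.L + 1))))
    (h_inner : ∀ l, 1 ≤ l → l < N.L →
      N.LayerCondition μ l (fun ω => θ ω l) (c l) {F | ‖F‖ = c (l + 1)})
    (h_input : N.LayerCondition μ N.L (fun ω => θ ω N.L) (c N.L) 𝒳)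
    -- the datapoint, and regularity of the error layer at it
    (x : Vec (N.d (N.L + 1))) (hx : x ∈ 𝒳) (y : Y)
    (herr_meas : Measurable (N.err y))
    (herr_diff : ∀ F, ‖F‖ = c 1 → DifferentiableAt ℝ (N.err y) F) :
    ∀ k l : ℕ, l < k → k ≤ N.L + 1 →
      -- for the error layer `l = 0`, it has to be invariant to the scale of its input, too
      (l = 0 → ∀ F, ‖F‖ = c 1 → HasDerivAt (fun a : ℝ => N.err y (a • F)) 0 1) →
      ENNReal.ofReal √((N.d k : ℝ) / ((N.d k : ℝ) - 1))
          * quadExp μ (fun ω => N.gsc k l (θ ω) x y) =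
        ∏ l' ∈ Finset.Icc (l + 1) k,
          ENNReal.ofReal √((N.d l' : ℝ) / ((N.d l' : ℝ) - 1))
            * quadExp μ (fun ω => N.gsc l' (l' - 1) (θ ω) x y) := by
  have H : N.IsLayerwiseUniform μ θ c x y :=
    { measurable_param := hθ_meas
      indep := hθ_indep
      two_le_width := hd
      length_pos := hc
      layer := by
        intro l hl1 hl
        rcases Nat.lt_or_eq_of_le hl with hlt | rfl
        · exact ⟨_, h_inner l hl1 hlt, fun _ h => h hlt⟩
        · refine ⟨𝒳, h_input, fun θ' _ => ?_⟩
          rw [N.value_top]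
          exact hx
      measurable_err := herr_meas
      differentiable_err := herr_diff }
  intro k l hlk hk hscale
  have hfactor : ∀ m, 1 ≤ m → m ≤ N.L + 1 → (0 : ℝ) ≤ (N.d m : ℝ) / ((N.d m : ℝ) - 1) := by
    intro m hm1 hm
    have : (2 : ℝ) ≤ N.d m := by exact_mod_cast hd m hm1 hm
    exact div_nonneg (by linarith) (by linarith)
  induction k, hlk using Nat.le_induction with
  | base => simp
  | succ k hlk ih =>
    have hlk' : l < k := hlk
    rw [Finset.prod_Icc_succ_top (by omega), ← ih (by omega), Nat.add_sub_cancel,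
      ofReal_sqrt_mul_quadExp (hfactor (k + 1) (by omega) hk),
      ofReal_sqrt_mul_quadExp (hfactor (k + 1) (by omega) hk),
      ofReal_sqrt_mul_quadExp (hfactor k (by omega) (by omega)),
      H.lintegral_gsc_sq_succ hlk' (by omega) hscale,
      ENNReal.mul_rpow_of_nonneg _ _ (by norm_num)]
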